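/- **Setting.** Let $n,m,d,s$ be integers with $n,m,d\ge 1$ and $1\le s<nm$, let $\sigma>0$ and $\mu>1$, and write $n\vee m=\max(n,m)$; $\log$ is the natural logarithm. Let $M^*=X^*Y^{*T}\in\mathbb R^{n\times m}$ with $X^*\in\mathbb R^{n\times d}$, $Y^*\in\mathbb R^{m\times d}$, and suppose that $\|X^*\|_\infty\le C_x$, $\|Y^*\|_\infty\le C_y$, $\|M^*\|_\infty\le C_m$, where $\|A\|_\infty=\max_{i,j}|A_{ij}|$. Let $M=M^*+N$, where $N$ has i.i.d. $\mathcal N(0,\sigma^2)$ entries, and let $\Omega\subseteq[n]\times[m]$ be a random index set, independent of $N$, that contains each pair $(i,j)$ independently with probability $s/(nm)$. One observes $(\Omega,\Phi_\Omega(M))$, where $\Phi_\Omega$ keeps the entries indexed by $\Omega$ and replaces the others by $0$. For a matrix $X$ with rows $x_1,\dots,x_p$, let $\mathcal G(X)$ be the partition of $\{1,\dots,p\}$ into subgroups, $i$ and $j$ being in the same subgroup if and only if $x_i=x_j$; so $|\mathcal G(X)|$ is the number of distinct rows of $X$. Let $K=2^{\lceil \mu\log_2(n\vee m)\rceil}$,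 let $\mathcal X$ be the set of $X\in\mathbb R^{n\times d}$ with all entries in $\{-C_x+\tfrac{2C_x}{K}t:\ t=0,\dots,K-1\}$, and let $\mathcal Y\subset\mathbb R^{m\times d}$ be defined in the same way with $C_y$ in place of $C_x$. For $\lambda\in\mathbb R$, the complexity-regularized maximum likelihood estimator is $\widehat M=\widehat X\widehat Y^T$, where $(\widehat X,\widehat Y)$ is a minimizer of $$\|\Phi_\Omega(M-XY^T)\|_F^2+\lambda\big(|\mathcal G(X)|+|\mathcal G(Y)|\big)$$ over all $(X,Y)\in\mathcal X\times\mathcal Y$ with $\|XY^T\|_\infty\le C_m$ (any measurable choice of minimizer, as a function of the data). **Theorem.** There are positive constants $C_1,C_2,C_3$ that depend only on $C_x,C_y,C_m$ such that, in the above setting, whenever $$\lambda\ \ge\ 8\mu d\Big(\sigma^2+\frac{4C_m^2}{3}\Big)\log(n\vee m),$$ the estimator satisfies $$\frac1{nm}\,\mathbb E\big[\|\widehat M-M^*\|_F^2\big]\ \le\ \frac{C_1\log s}{s}+\frac{d\,C_2}{(\mu\log(n\vee m))^2}+\Big(\frac{6\lambda}{\log(n\vee m)}+\mu C_3\Big)\Big(\frac{m+n+2}{s}\log(n\vee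 m)+\frac{(|\mathcal G(X^*)|+|\mathcal G(Y^*)|)\,d}{s}\log(n\vee m)\Big),$$ where the expectation is with respect to the joint distribution of $(\Omega,\Phi_\Omega(M))$. -/

import Mathlib

open MeasureTheory ProbabilityTheory

noncomputable section

namespace SubgroupCompletion

/-- Two indices belong to the same subgroup when their feature vectors (the corresponding rows)
coincide; `subgroups X` is the resulting partition of the index set `{1, …, p}`. -/
def subgroups {p d : ℕ} (X : Matrix (Fin p) (Fin d) ℝ) : Set (Set (Fin p)) :=
  (Setoid.ker fun i => X i).classes

/-- The number of subgroups, `|𝒢(X)|`. -/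
def numSubgroups {p d : ℕ} (X : Matrix (Fin p) (Fin d) ℝ) : ℕ :=
  (subgroups X).ncard

/-- The number of subgroups is the number of distinct rows. -/
theorem numSubgroups_eq {p d : ℕ} (X : Matrix (Fin p) (Fin d) ℝ) :
    numSubgroups X = (Set.range fun i => X i).ncard := by
  rw [numSubgroups, subgroups, ← Nat.card_coe_set_eq, ← Nat.card_coe_set_eq]
  exact Nat.card_congr
    ((Setoid.quotientEquivClasses _).symm.trans (Setoid.quotientKerEquivRange _))

/-- The squared Frobenius norm. -/
def frobSq {n m : ℕ} (A : Matrix (Fin n) (Fin m) ℝ) : ℝ :=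
  ∑ i, ∑ j, A i j ^ 2

/-- The entrywise bound `‖A‖_∞ ≤ C`. -/
def EntryBound {n m : ℕ} (A : Matrix (Fin n) (Fin m) ℝ) (C : ℝ) : Prop :=
  ∀ i j, |A i j| ≤ C

/-- The number of quantization levels `K = 2 ^ ⌈μ log₂ (n ∨ m)⌉`. -/
def numLevels (n m : ℕ) (μ : ℝ) : ℕ :=
  2 ^ ⌈μ * Real.logb 2 (max n m : ℕ)⌉₊

/-- The `p × d` matrices all of whose entries lie in the grid
`{-C + (2 C / K) t : t = 0, …, K - 1}`. -/
def gridMatrices (p d : ℕ) (C : ℝ) (K : ℕ) : Set (Matrix (Fin p) (Fin d) ℝ) :=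
  {X | ∀ i j, ∃ t : ℕ, t < K ∧ X i j = -C + 2 * C / K * t}

/-- The admissible factorizations: pairs `(X, Y)` of discretized factors with
`‖X Yᵀ‖_∞ ≤ C_m`. -/
def candidates (n m d : ℕ) (μ Cx Cy Cm : ℝ) :
    Set (Matrix (Fin n) (Fin d) ℝ × Matrix (Fin m) (Fin d) ℝ) :=
  {F | F.1 ∈ gridMatrices n d Cx (numLevels n m μ) ∧
    F.2 ∈ gridMatrices m d Cy (numLevels n m μ) ∧ EntryBound (F.1 * F.2.transpose) Cm}

/-- The projection `Φ_S`: it keeps the entries with index in `S` and sets the others to zero. -/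
def proj {n m : ℕ} (S : Set (Fin n × Fin m)) (A : Matrix (Fin n) (Fin m) ℝ) :
    Matrix (Fin n) (Fin m) ℝ :=
  Matrix.of fun i j => S.indicator (fun q => A q.1 q.2) (i, j)

/-- The data: the observed index set together with the projected noisy matrix. -/
abbrev Data (n m : ℕ) : Type :=
  Set (Fin n × Fin m) × (Fin n → Fin m → ℝ)

/-- The criterion `‖Φ_Ω(M - X Yᵀ)‖_F² + λ (|𝒢(X)| + |𝒢(Y)|)`, written in terms of the
data `D = (Ω, Φ_Ω(M))`; the projection `Φ_Ω` is idempotent. -/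
def criterion {n m d : ℕ} (lam : ℝ) (D : Data n m)
    (F : Matrix (Fin n) (Fin d) ℝ × Matrix (Fin m) (Fin d) ℝ) : ℝ :=
  frobSq (proj D.1 (Matrix.of D.2 - F.1 * F.2.transpose)) +
    lam * ((numSubgroups F.1 : ℝ) + (numSubgroups F.2 : ℝ))

/-- `H` is a value of the complexity-regularized maximum likelihood estimator at the data `D`:
it is the product of a factorization that minimizes the criterion over all candidates. -/
def IsEstimate {n m : ℕ} (d : ℕ) (μ Cx Cy Cm lam : ℝ) (D : Data n m)
    (H : Matrix (Fin n) (Fin m) ℝ) : Prop :=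
  ∃ F ∈ candidates n m d μ Cx Cy Cm, H = F.1 * F.2.transpose ∧
    ∀ F' ∈ candidates n m d μ Cx Cy Cm, criterion lam D F ≤ criterion lam D F'

/-- The sampling probability `s / (n m)`. -/
def sampleProb {n m s : ℕ} (hs : s < n * m) : unitInterval :=
  ⟨(s : ℝ) / ((n : ℝ) * (m : ℝ)), by positivity,
    div_le_one_of_le₀ (by exact_mod_cast hs.le) (by positivity)⟩

/-- The law of the noise matrix: independent `𝒩(0, σ²)` entries. -/
def noiseLaw (n m : ℕ) (σ : ℝ) : Measure (Fin n → Fin m → ℝ) :=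
  Measure.pi fun _ => Measure.pi fun _ => gaussianReal 0 (σ ^ 2).toNNReal

instance (n m : ℕ) (σ : ℝ) : IsProbabilityMeasure (noiseLaw n m σ) := by
  unfold noiseLaw; infer_instance

/-- The joint law of `(Ω, Φ_Ω(M))`, where `M = M* + N`, each index pair belongs to `Ω`
independently with probability `p`, and the noise `N` is independent of `Ω`. -/
def dataLaw {n m : ℕ} (p : unitInterval) (σ : ℝ) (Mstar : Matrix (Fin n) (Fin m) ℝ) :
    Measure (Data n m) :=
  ((setBernoulli Set.univ p).prod (noiseLaw n m σ)).map
    fun q => (q.1, proj q.1 (Mstar + Matrix.of q.2))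

/-- The observation map is measurable, so `dataLaw` is a genuine image measure. -/
theorem measurable_observe {n m : ℕ} (Mstar : Matrix (Fin n) (Fin m) ℝ) :
    Measurable fun q : Data n m => ((q.1, proj q.1 (Mstar + Matrix.of q.2)) : Data n m) := by
  classical
  refine Measurable.prodMk measurable_fst ?_
  refine measurable_pi_lambda _ fun i => measurable_pi_lambda _ fun j => ?_
  have h : MeasurableSet {q : Data n m | (i, j) ∈ q.1} :=
    measurable_fst (MeasurableSet.of_discrete (s := {S : Set (Fin n × Fin m) | (i, j) ∈ S}))
  have e : (fun q : Data n m => proj q.1 (Mstar + Matrix.of q.2) i j) =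
      fun q => if (i, j) ∈ q.1 then Mstar i j + q.2 i j else 0 := by
    funext q
    simp [proj, Set.indicator_apply]
  change Measurable (fun q : Data n m => proj q.1 (Mstar + Matrix.of q.2) i j)
  rw [e]
  refine Measurable.ite h ?_ measurable_const
  exact measurable_const.add
    ((measurable_pi_apply j).comp ((measurable_pi_apply i).comp measurable_snd))

instance {n m : ℕ} (p : unitInterval) (σ : ℝ) (Mstar : Matrix (Fin n) (Fin m) ℝ) :
    IsProbabilityMeasure (dataLaw p σ Mstar) :=
  Measure.isProbabilityMeasure_map (measurable_observe Mstar).aemeasurable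

end SubgroupCompletion

end

/-!
The estimator is analysed by comparing its criterion with the one that the true matrix `M*` would
have. For a matrix `A` (an error `X Yᵀ - M*`) the difference of the two losses is
`excessLoss A = ∑_{(i,j) ∈ Ω} (A i j ^ 2 - 2 * A i j * N i j)`, whose mean is `p * ‖A‖_F²` with
`p = s / (n m)` (`integral_excessLoss`). For the step `η = 1 / (4 (σ² + 4 Cm² / 3))` the Gaussian
and Bernoulli averages are explicit products and give
`𝔼 exp (-η * excessLoss A) ≤ exp (-(p η / 3) ‖A‖_F²)` (`integral_exp_neg_excessLoss_le`).

A candidate is encoded by the grid codes of its entries. A map `Fin p → A` is determined by a choice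
of representatives of its fibres and its values there, so the weights
`p^{-p} K^{-d |𝒢(X)|}` sum to at most one (`sum_inv_card_pow_ncard_range_le`,
`sum_codeWeight_le_one`), and the lower bound on `λ` makes the penalty dominate the part of the
code length that grows with `|𝒢|`. Summing the exponential moments with these weights and using
`x + 1 ≤ exp x` bounds the risk of the minimizer by the excess loss and the penalty of any fixed
candidate, plus `(n + m) log (n ∨ m)` (`oracle_inequality`, `risk_le_of_candidate`).

The fixed candidate is obtained by rounding `Y*` and a slightly shrunk `X*` to the grid, the
shrinking being what keeps the product within the bound `Cm` (`exists_candidate_near`). Its squared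
entrywise error is of order `d / K`, and `K ≥ exp (μ log (n ∨ m))` turns this into the term with
`(μ log (n ∨ m))²`. The bound needs no term of order `log s / s`, so any positive constants `C₁` and
`C₃` are admissible.
-/

open MeasureTheory ProbabilityTheory

namespace SubgroupCompletion

/-! ### Counting maps by the size of their range -/

/-- A map is constant on the fibres of a map `r` choosing one representative per fibre, hence
determined by `r` and its values on the range of `r`; there are at most `p ^ p` choices of `r`. -/
theorem sum_inv_card_pow_ncard_range_le {A : Type*} [Fintype A] [Nonempty A] (p : ℕ) :
    ∑ f : Fin p → A, ((Fintype.card A : ℝ)⁻¹) ^ (Set.range f).ncard ≤ (p : ℝ) ^ p := by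
  classical
  have hA : (0 : ℝ) < Fintype.card A := by exact_mod_cast Fintype.card_pos
  have key : ∀ f : Fin p → A, ∃ r : Fin p → Fin p,
      f ∘ r = f ∧ (Set.range f).ncard = (Set.range r).ncard := by
    intro f
    have h : ∀ y : Set.range f, ∃ x, f x = y := fun y => y.2
    choose g hg using h
    have hginj : Function.Injective g := fun a b hab => by
      apply Subtype.ext
      rw [← hg a, ← hg b, hab]
    refine ⟨fun x => g ⟨f x, x, rfl⟩, funext fun x => hg _, ?_⟩
    have : Set.range (fun x => g ⟨f x, x, rfl⟩) = Set.range g := by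
      ext z
      constructor
      · rintro ⟨x, rfl⟩
        exact ⟨_, rfl⟩
      · rintro ⟨⟨_, x, rfl⟩, rfl⟩
        exact ⟨x, rfl⟩
    have hg' := Set.ncard_image_of_injective Set.univ hginj
    rw [Set.image_univ, Set.ncard_univ, Nat.card_coe_set_eq] at hg'
    rw [this, hg']
  choose r hr hcard using key
  have hfib : ∀ c : Fin p → Fin p,
      ∑ f : Fin p → A with r f = c, ((Fintype.card A : ℝ)⁻¹) ^ (Set.range f).ncard ≤ 1 := by
    intro c
    have h1 : ∀ f ∈ Finset.univ.filter (fun f : Fin p → A => r f = c),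
        ((Fintype.card A : ℝ)⁻¹) ^ (Set.range f).ncard =
          ((Fintype.card A : ℝ)⁻¹) ^ (Set.range c).ncard := by
      intro f hf
      rw [hcard f, (Finset.mem_filter.1 hf).2]
    rw [Finset.sum_congr rfl h1, Finset.sum_const, nsmul_eq_mul]
    have h2 : (Finset.univ.filter (fun f : Fin p → A => r f = c)).card ≤
        Fintype.card (Set.range c → A) := by
      rw [← Finset.card_univ]
      refine Finset.card_le_card_of_injOn (fun f z => f z) (fun _ _ => Finset.mem_univ _) ?_
      intro f hf g hg hfg
      have hf' : r f = c := by simpa using hf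
      have hg' : r g = c := by simpa using hg
      funext x
      have := congrFun hfg ⟨c x, x, rfl⟩
      have e1 := congrFun (hr f) x
      have e2 := congrFun (hr g) x
      rw [hf'] at e1
      rw [hg'] at e2
      exact e1.symm.trans (this.trans e2)
    rw [Fintype.card_fun, ← Nat.card_eq_fintype_card (α := Set.range c),
      Nat.card_coe_set_eq] at h2
    have h3 : ((Finset.univ.filter (fun f : Fin p → A => r f = c)).card : ℝ) ≤
        (Fintype.card A : ℝ) ^ (Set.range c).ncard := by exact_mod_cast h2
    calc _ ≤ (Fintype.card A : ℝ) ^ (Set.range c).ncard *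
          ((Fintype.card A : ℝ)⁻¹) ^ (Set.range c).ncard := by gcongr
      _ = 1 := by rw [← mul_pow, mul_inv_cancel₀ hA.ne', one_pow]
  rw [← Finset.sum_fiberwise Finset.univ r]
  calc _ ≤ ∑ _c : Fin p → Fin p, (1 : ℝ) := Finset.sum_le_sum fun c _ => hfib c
    _ = (p : ℝ) ^ p := by simp

/-! ### Moments of the excess loss -/

/-- The amount by which the squared loss on the sampled entries changes when the true matrix is
replaced by the true matrix plus `A`, as a function of the index set and the noise. -/
noncomputable def excessLoss {n m : ℕ} (A : Matrix (Fin n) (Fin m) ℝ) (q : Data n m) : ℝ :=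
  open Classical in
  ∑ i, ∑ j, if (i, j) ∈ q.1 then A i j ^ 2 - 2 * A i j * q.2 i j else 0

theorem integral_prod_setBernoulli {ι : Type*} [Fintype ι] (p : unitInterval)
    (g : ι → Prop → ℝ) :
    ∫ S, ∏ i, g i (i ∈ S) ∂setBernoulli (Set.univ : Set ι) p =
      ∏ i, ((p : ℝ) * g i True + (1 - p) * g i False) := by
  rw [setBernoulli_eq_map, integral_map (by fun_prop)
    (measurable_of_finite _).aestronglyMeasurable, Measure.infinitePi_eq_pi]
  simp only [Set.mem_ofPred_eq]
  rw [integral_fintype_prod_eq_prod]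
  refine Finset.prod_congr rfl fun i _ => ?_
  have := integral_bernoulliMeasure True False p (g i)
  simpa [bernoulliMeasure_def] using this

theorem integral_prod_noiseLaw {n m : ℕ} (σ : ℝ) (g : Fin n → Fin m → ℝ → ℝ) :
    ∫ N, ∏ i, ∏ j, g i j (N i j) ∂noiseLaw n m σ =
      ∏ i, ∏ j, ∫ x, g i j x ∂gaussianReal 0 (σ ^ 2).toNNReal := by
  rw [noiseLaw, integral_fintype_prod_eq_prod
    (f := fun (i : Fin n) (v : Fin m → ℝ) => ∏ j, g i j (v j))]
  exact Finset.prod_congr rfl fun i _ => integral_fintype_prod_eq_prod _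

theorem integrable_prod_noiseLaw {n m : ℕ} (σ : ℝ) (g : Fin n → Fin m → ℝ → ℝ)
    (hg : ∀ i j, Integrable (g i j) (gaussianReal 0 (σ ^ 2).toNNReal)) :
    Integrable (fun N => ∏ i, ∏ j, g i j (N i j)) (noiseLaw n m σ) :=
  Integrable.fintype_prod (f := fun (i : Fin n) (v : Fin m → ℝ) => ∏ j, g i j (v j))
    fun i => Integrable.fintype_prod (hg i)

theorem measurePreserving_noise_eval {n m : ℕ} (σ : ℝ) (i : Fin n) (j : Fin m) :
    MeasurePreserving (fun N : Fin n → Fin m → ℝ => N i j) (noiseLaw n m σ)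
      (gaussianReal 0 (σ ^ 2).toNNReal) :=
  (measurePreserving_eval (fun _ : Fin m => gaussianReal 0 (σ ^ 2).toNNReal) j).comp
    (measurePreserving_eval (fun _ : Fin n => Measure.pi fun _ : Fin m =>
      gaussianReal 0 (σ ^ 2).toNNReal) i)

theorem integrable_noise_eval {n m : ℕ} (σ : ℝ) (i : Fin n) (j : Fin m) :
    Integrable (fun N : Fin n → Fin m → ℝ => N i j) (noiseLaw n m σ) :=
  (measurePreserving_noise_eval σ i j).integrable_comp_of_integrable
    (g := id) ((memLp_id_gaussianReal 1).integrable le_rfl)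

theorem measurable_excessLoss {n m : ℕ} (A : Matrix (Fin n) (Fin m) ℝ) :
    Measurable (excessLoss A) := by
  classical
  refine measurable_from_prod_countable_right fun S => ?_
  unfold excessLoss
  refine Finset.measurable_sum _ fun i _ => Finset.measurable_sum _ fun j _ => ?_
  by_cases h : (i, j) ∈ S
  · simp only [h, if_true]; fun_prop
  · simp only [h, if_false]; fun_prop

/-- The index set takes finitely many values, so integrability in the noise suffices. -/
theorem integrable_prod_of_section {n m : ℕ} (p : unitInterval) (σ : ℝ) {f : Data n m → ℝ}
    (hf : Measurable f) (h : ∀ S, Integrable (fun N => f (S, N)) (noiseLaw n m σ)) :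
    Integrable f ((setBernoulli Set.univ p).prod (noiseLaw n m σ)) := by
  rw [integrable_prod_iff hf.aestronglyMeasurable]
  exact ⟨.of_forall h, Integrable.of_finite⟩

theorem integrable_excessLoss {n m : ℕ} (p : unitInterval) (σ : ℝ)
    (A : Matrix (Fin n) (Fin m) ℝ) :
    Integrable (excessLoss A) ((setBernoulli Set.univ p).prod (noiseLaw n m σ)) := by
  classical
  refine integrable_prod_of_section p σ (measurable_excessLoss A) fun S => ?_
  unfold excessLoss
  refine integrable_finsetSum _ fun i _ => integrable_finsetSum _ fun j _ => ?_
  by_cases h : (i, j) ∈ S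
  · simp only [h, if_true]
    exact (integrable_const _).sub ((integrable_noise_eval σ i j).const_mul _)
  · simp only [h, if_false]; exact integrable_const _

theorem integral_excessLoss {n m : ℕ} (p : unitInterval) (σ : ℝ)
    (A : Matrix (Fin n) (Fin m) ℝ) :
    ∫ q, excessLoss A q ∂(setBernoulli Set.univ p).prod (noiseLaw n m σ) = p * frobSq A := by
  classical
  have hN := integrable_noise_eval (n := n) (m := m) σ
  have hN0 : ∀ i j, ∫ N, N i j ∂noiseLaw n m σ = 0 := fun i j => by
    have h := (measurePreserving_noise_eval (n := n) (m := m) σ i j)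
    have := integral_map (μ := noiseLaw n m σ) (f := fun x : ℝ => x) h.measurable.aemeasurable
      (by fun_prop)
    rw [h.map_eq, integral_id_gaussianReal] at this
    exact this.symm
  rw [integral_prod _ (integrable_excessLoss p σ A)]
  have h1 : ∀ S : Set (Fin n × Fin m), ∫ N, excessLoss A (S, N) ∂noiseLaw n m σ =
      ∑ i, ∑ j, A i j ^ 2 * (if (i, j) ∈ S then 1 else 0) := by
    intro S
    have hint : ∀ i j, Integrable (fun N : Fin n → Fin m → ℝ =>
        if (i, j) ∈ S then A i j ^ 2 - 2 * A i j * N i j else 0) (noiseLaw n m σ) := by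
      intro i j
      by_cases h : (i, j) ∈ S
      · simp only [h, if_true]
        exact (integrable_const _).sub ((hN i j).const_mul _)
      · simp only [h, if_false]; exact integrable_const _
    unfold excessLoss
    rw [integral_finsetSum _ fun i _ => integrable_finsetSum _ fun j _ => hint i j]
    refine Finset.sum_congr rfl fun i _ => ?_
    rw [integral_finsetSum _ fun j _ => hint i j]
    refine Finset.sum_congr rfl fun j _ => ?_
    by_cases h : (i, j) ∈ S
    · simp only [h, if_true]
      rw [integral_sub (integrable_const _) ((hN i j).const_mul _), integral_const_mul, hN0]
      simp
    · simp [h]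
  simp_rw [h1]
  rw [integral_finsetSum _ fun i _ => Integrable.of_finite, frobSq, Finset.mul_sum]
  refine Finset.sum_congr rfl fun i _ => ?_
  rw [integral_finsetSum _ fun j _ => Integrable.of_finite, Finset.mul_sum]
  refine Finset.sum_congr rfl fun j _ => ?_
  rw [integral_const_mul, mul_comm]
  congr 1
  have h2 := integral_prod_setBernoulli p (ι := Fin n × Fin m)
    (fun q P => if q = (i, j) then (if P then (1 : ℝ) else 0) else 1)
  have e : ∀ S : Set (Fin n × Fin m),
      ∏ q, (if q = (i, j) then (if q ∈ S then (1 : ℝ) else 0) else 1) =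
        if (i, j) ∈ S then 1 else 0 := by
    intro S
    rw [Finset.prod_ite_eq' Finset.univ (i, j) (fun q => if q ∈ S then (1 : ℝ) else 0)]
    simp
  simp_rw [e] at h2
  rw [h2, Finset.prod_eq_single (i, j)]
  · simp
  · intro q _ hq
    simp [hq]
  · simp

theorem integrable_exp_neg_excessLoss {n m : ℕ} (p : unitInterval) (σ η : ℝ)
    (A : Matrix (Fin n) (Fin m) ℝ) :
    Integrable (fun q => Real.exp (-η * excessLoss A q))
      ((setBernoulli Set.univ p).prod (noiseLaw n m σ)) := by
  classical
  refine integrable_prod_of_section p σ ((measurable_excessLoss A).const_mul _).exp fun S => ?_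
  have := integrable_prod_noiseLaw (n := n) (m := m) σ (fun i j x =>
    Real.exp (-η * if (i, j) ∈ S then A i j ^ 2 - 2 * A i j * x else 0)) (fun i j => by
      by_cases h : (i, j) ∈ S
      · simp only [h, if_true]
        have := (integrable_exp_mul_gaussianReal (μ := 0) (v := (σ ^ 2).toNNReal)
          (2 * η * A i j)).const_mul (Real.exp (-η * A i j ^ 2))
        refine this.congr (.of_forall fun x => ?_)
        simp only [← Real.exp_add]
        congr 1; ring
      · simp only [h, if_false]; exact integrable_const _)
  refine this.congr (.of_forall fun N => ?_)
  simp only [excessLoss, Finset.mul_sum, Real.exp_sum]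

/-- With a step `η` at most a quarter of the inverse variance, the Gaussian factor costs only half
of the quadratic term; the Bernoulli average then loses a further factor `2 / 3` because
`1 - exp (-x) ≥ x / (1 + x)`. -/
theorem integral_exp_neg_excessLoss_le {n m : ℕ} (p : unitInterval) {σ η : ℝ} (hη : 0 ≤ η)
    (hσ : η * σ ^ 2 ≤ 1 / 4) {A : Matrix (Fin n) (Fin m) ℝ} (hA : ∀ i j, η * A i j ^ 2 ≤ 3 / 4) :
    ∫ q, Real.exp (-η * excessLoss A q) ∂(setBernoulli Set.univ p).prod (noiseLaw n m σ) ≤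
      Real.exp (-(p * η / 3) * frobSq A) := by
  classical
  have hp0 : (0 : ℝ) ≤ p := p.2.1
  have hp1 : (p : ℝ) ≤ 1 := p.2.2
  rw [integral_prod _ (integrable_exp_neg_excessLoss p σ η A)]
  have h1 : ∀ S : Set (Fin n × Fin m),
      ∫ N, Real.exp (-η * excessLoss A (S, N)) ∂noiseLaw n m σ =
        ∏ q : Fin n × Fin m, if q ∈ S then
          Real.exp (-η * A q.1 q.2 ^ 2 + 2 * η ^ 2 * A q.1 q.2 ^ 2 * σ ^ 2) else 1 := by
    intro S
    simp only [excessLoss, Finset.mul_sum, Real.exp_sum]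
    rw [integral_prod_noiseLaw σ (fun i j x =>
      Real.exp (-η * if (i, j) ∈ S then A i j ^ 2 - 2 * A i j * x else 0)),
      ← Finset.univ_product_univ, Finset.prod_product]
    refine Finset.prod_congr rfl fun i _ => Finset.prod_congr rfl fun j _ => ?_
    by_cases h : (i, j) ∈ S
    · simp only [h, if_true]
      have e : ∀ x : ℝ, Real.exp (-η * (A i j ^ 2 - 2 * A i j * x)) =
          Real.exp (-η * A i j ^ 2) * Real.exp ((2 * η * A i j) * x) := fun x => by
        rw [← Real.exp_add]; congr 1; ring
      have hm := congrFun (mgf_fun_id_gaussianReal (μ := 0) (v := (σ ^ 2).toNNReal))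
        (2 * η * A i j)
      simp only [mgf] at hm
      simp_rw [e]
      rw [integral_const_mul, hm, ← Real.exp_add, Real.coe_toNNReal _ (sq_nonneg σ)]
      congr 1; ring
    · simp [h]
  simp_rw [h1]
  rw [integral_prod_setBernoulli p (ι := Fin n × Fin m) (fun q P => if P then
    Real.exp (-η * A q.1 q.2 ^ 2 + 2 * η ^ 2 * A q.1 q.2 ^ 2 * σ ^ 2) else 1)]
  have h2 : Real.exp (-(p * η / 3) * frobSq A) =
      ∏ q : Fin n × Fin m, Real.exp (-(p * η / 3) * A q.1 q.2 ^ 2) := by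
    rw [← Real.exp_sum, ← Finset.mul_sum, frobSq, ← Finset.univ_product_univ,
      Finset.sum_product]
  rw [h2]
  refine Finset.prod_le_prod (fun q _ => ?_) fun q _ => ?_
  · simp only [if_true, if_false]
    have := sub_nonneg.2 hp1
    positivity
  · simp only [if_true, if_false]
    set x := η * A q.1 q.2 ^ 2 / 2 with hx
    have hx0 : 0 ≤ x := by positivity
    have hx1 : x ≤ 1 / 2 := by have := hA q.1 q.2; linarith
    have hle : Real.exp (-η * A q.1 q.2 ^ 2 + 2 * η ^ 2 * A q.1 q.2 ^ 2 * σ ^ 2) ≤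
        1 - 2 / 3 * x := by
      calc _ ≤ Real.exp (-x) := by
            apply Real.exp_le_exp.2
            have : (η * A q.1 q.2 ^ 2) * (η * σ ^ 2) ≤ (η * A q.1 q.2 ^ 2) * (1 / 4) := by gcongr
            rw [hx]; nlinarith
        _ ≤ (1 + x)⁻¹ := by
            rw [Real.exp_neg]
            gcongr
            linarith [Real.add_one_le_exp x]
        _ ≤ 1 - 2 / 3 * x := by
            rw [inv_le_iff_one_le_mul₀ (by positivity)]
            nlinarith
    calc _ ≤ (p : ℝ) * (1 - 2 / 3 * x) + (1 - p) * 1 := by gcongr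
      _ = (-(p * η / 3) * A q.1 q.2 ^ 2) + 1 := by rw [hx]; ring
      _ ≤ _ := Real.add_one_le_exp _

/-! ### An oracle inequality for weighted finite families -/

/-- The exponential moment bound is summed over the family with weights `w`; the bound
`x + 1 ≤ exp x` then converts it into a bound in expectation for whichever index the data select,
so the selected index need not depend measurably on the data. -/
theorem oracle_inequality {n m : ℕ} (p : unitInterval) {σ η : ℝ} (hη : 0 < η)
    (hσ : η * σ ^ 2 ≤ 1 / 4) {ι : Type*} [Fintype ι] (A : ι → Matrix (Fin n) (Fin m) ℝ)
    (hA : ∀ k i j, η * A k i j ^ 2 ≤ 3 / 4) (w : ι → ℝ) (hw : ∀ k, 0 < w k) (hw1 : ∑ k, w k ≤ 1)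
    (pen : ι → ℝ) {lam W : ℝ} (hpen : ∀ k, -Real.log (w k) ≤ W + η * (lam * pen k))
    (A₀ : Matrix (Fin n) (Fin m) ℝ) (pen₀ : ℝ) (err : Data n m → ℝ)
    (herr : Integrable err ((setBernoulli Set.univ p).prod (noiseLaw n m σ)))
    (hsel : ∀ᵐ q ∂(setBernoulli Set.univ p).prod (noiseLaw n m σ), ∃ k, err q = frobSq (A k) ∧
      excessLoss (A k) q + lam * pen k ≤ excessLoss A₀ q + lam * pen₀) :
    p * η / 3 * ∫ q, err q ∂(setBernoulli Set.univ p).prod (noiseLaw n m σ) ≤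
      η * (p * frobSq A₀ + lam * pen₀) + W := by
  set P := (setBernoulli Set.univ p).prod (noiseLaw n m σ) with hP
  let S : Data n m → ℝ := fun q => ∑ k, w k * Real.exp (p * η / 3 * frobSq (A k)) *
    Real.exp (-η * excessLoss (A k) q)
  have hSi : Integrable S P := integrable_finsetSum _ fun k _ =>
    (integrable_exp_neg_excessLoss p σ η (A k)).const_mul _
  have hS : ∫ q, S q ∂P ≤ 1 := by
    rw [integral_finsetSum _ fun k _ =>
      (integrable_exp_neg_excessLoss p σ η (A k)).const_mul _]
    refine le_trans (Finset.sum_le_sum fun k _ => ?_) hw1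
    rw [integral_const_mul]
    calc _ ≤ w k * Real.exp (p * η / 3 * frobSq (A k)) *
          Real.exp (-(p * η / 3) * frobSq (A k)) := by
          have := hw k
          gcongr
          exact integral_exp_neg_excessLoss_le p hη.le hσ (hA k)
      _ = w k := by
          rw [mul_assoc, ← Real.exp_add, neg_mul, add_neg_cancel, Real.exp_zero, mul_one]
  have hpt : ∀ᵐ q ∂P, p * η / 3 * err q ≤
      (S q - 1) + (η * excessLoss A₀ q + (η * (lam * pen₀) + W)) := by
    filter_upwards [hsel] with q hq
    obtain ⟨k, hk, hmin⟩ := hq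
    have h1 : w k * Real.exp (p * η / 3 * frobSq (A k)) * Real.exp (-η * excessLoss (A k) q) ≤
        S q :=
      Finset.single_le_sum (f := fun k => w k * Real.exp (p * η / 3 * frobSq (A k)) *
        Real.exp (-η * excessLoss (A k) q))
        (fun k _ => by have := hw k; positivity) (Finset.mem_univ k)
    have h2 : Real.exp (Real.log (w k) + p * η / 3 * frobSq (A k) + -η * excessLoss (A k) q) ≤
        S q := by
      rw [Real.exp_add, Real.exp_add, Real.exp_log (hw k)]
      exact h1
    have h3 := (Real.add_one_le_exp _).trans h2
    have h4 := hpen k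
    have h5 := mul_le_mul_of_nonneg_left hmin hη.le
    rw [hk]
    linarith
  have hZ := (integrable_excessLoss p σ A₀).const_mul η
  have := integral_mono_ae (herr.const_mul (p * η / 3))
    ((hSi.sub (integrable_const 1)).add (hZ.add (integrable_const (η * (lam * pen₀) + W)))) hpt
  rw [integral_const_mul] at this
  refine this.trans ?_
  rw [integral_add' (hSi.sub (integrable_const 1)) (hZ.add (integrable_const _)),
    integral_sub' hSi (integrable_const 1), integral_add' hZ (integrable_const _),
    integral_const_mul, integral_excessLoss]
  simp only [integral_const, probReal_univ, smul_eq_mul, one_mul]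
  linarith

/-! ### Codes for the discretized factors -/

/-- The grid point with code `t`. -/
noncomputable def gridPoint (C : ℝ) (K : ℕ) (t : ℕ) : ℝ := -C + 2 * C / K * t

/-- The matrix whose entries have the codes `T`. -/
noncomputable def decode {p d : ℕ} (C : ℝ) {K : ℕ} (T : Fin p → Fin d → Fin K) :
    Matrix (Fin p) (Fin d) ℝ :=
  Matrix.of fun i j => gridPoint C K (T i j)

/-- For `C = 0` different codes give the same matrix, so the code is chosen as a function of the
entry, which keeps the number of distinct rows from growing. -/
theorem exists_code {p d : ℕ} {C : ℝ} {K : ℕ} (hK : 0 < K) {X : Matrix (Fin p) (Fin d) ℝ}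
    (hX : X ∈ gridMatrices p d C K) :
    ∃ T : Fin p → Fin d → Fin K, decode C T = X ∧ (Set.range T).ncard ≤ numSubgroups X := by
  have : Nonempty (Fin K) := ⟨⟨0, hK⟩⟩
  let φ : ℝ → Fin K := Function.invFun fun t : Fin K => gridPoint C K t
  refine ⟨fun i j => φ (X i j), ?_, ?_⟩
  · ext i j
    obtain ⟨t, ht, e⟩ := hX i j
    exact Function.invFun_eq (f := fun t : Fin K => gridPoint C K t) ⟨⟨t, ht⟩, e.symm⟩
  · rw [numSubgroups_eq]
    have : Set.range (fun i j => φ (X i j)) =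
        (fun r : Fin d → ℝ => fun j => φ (r j)) '' Set.range fun i => X i := by
      rw [← Set.range_comp]; rfl
    rw [this]
    exact Set.ncard_image_le (Set.finite_range _)

/-- The weight of a code: the inverse of the number of ways to partition the rows and to choose
a vector of codes for each part. -/
noncomputable def codeWeight {p d K : ℕ} (T : Fin p → Fin d → Fin K) : ℝ :=
  ((p : ℝ) ^ p)⁻¹ * (((K : ℝ) ^ d)⁻¹) ^ (Set.range T).ncard

theorem codeWeight_pos {p d K : ℕ} (hp : 0 < p) (hK : 0 < K) (T : Fin p → Fin d → Fin K) :
    0 < codeWeight T := by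
  unfold codeWeight; positivity

theorem sum_codeWeight_le_one {p d K : ℕ} (hp : 0 < p) (hK : 0 < K) :
    ∑ T : Fin p → Fin d → Fin K, codeWeight T ≤ 1 := by
  have : Nonempty (Fin K) := ⟨⟨0, hK⟩⟩
  have h := sum_inv_card_pow_ncard_range_le (A := Fin d → Fin K) p
  simp only [Fintype.card_fun, Fintype.card_fin, Nat.cast_pow] at h
  unfold codeWeight
  rw [← Finset.mul_sum, inv_mul_le_iff₀ (by positivity), mul_one]
  exact h

theorem neg_log_codeWeight {p d K : ℕ} (hp : 0 < p) (hK : 0 < K) (T : Fin p → Fin d → Fin K) :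
    -Real.log (codeWeight T) =
      p * Real.log p + d * Real.log K * (Set.range T).ncard := by
  unfold codeWeight
  rw [Real.log_mul (by positivity) (by positivity), Real.log_inv, Real.log_pow, Real.log_pow,
    Real.log_inv, Real.log_pow]
  ring

/-! ### Discretization of the true factors -/

theorem exists_rounding {C : ℝ} (hC : 0 ≤ C) {K : ℕ} (hK : 0 < K) :
    ∃ r : ℝ → ℝ, ∀ x, |x| ≤ C →
      (∃ t : ℕ, t < K ∧ r x = -C + 2 * C / K * t) ∧ |x - r x| ≤ 2 * C / K ∧ |r x| ≤ C := by
  have hK' : (0 : ℝ) < K := by exact_mod_cast hK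
  suffices h : ∀ x : ℝ, ∃ y : ℝ, |x| ≤ C →
      (∃ t : ℕ, t < K ∧ y = -C + 2 * C / K * t) ∧ |x - y| ≤ 2 * C / K ∧ |y| ≤ C by
    choose r hr using h
    exact ⟨r, hr⟩
  intro x
  have hb : ∀ t : ℕ, t < K → |-C + 2 * C / K * t| ≤ C := by
    intro t ht
    have ht' : (t : ℝ) ≤ K := by exact_mod_cast ht.le
    have h1 : 2 * C / K * t ≤ 2 * C / K * K := by gcongr
    rw [div_mul_cancel₀ _ hK'.ne'] at h1
    have h2 : 0 ≤ 2 * C / K * t := by positivity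
    rw [abs_le]; constructor <;> linarith
  rcases hC.eq_or_lt with rfl | hC'
  · refine ⟨0, fun hx => ⟨⟨0, hK, by simp⟩, by simpa using hx, by simp⟩⟩
  by_cases hx : |x| ≤ C
  swap
  · exact ⟨0, fun h => absurd h hx⟩
  obtain ⟨hx1, hx2⟩ := abs_le.1 hx
  have hstep : 0 < 2 * C / K := by positivity
  rcases hx2.eq_or_lt with rfl | hlt
  · -- the right end point is not on the grid: its neighbour is at distance exactly one step
    refine ⟨_, fun _ => ⟨⟨K - 1, by omega, rfl⟩, ?_, hb _ (by omega)⟩⟩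
    rw [Nat.cast_sub (by omega), Nat.cast_one, mul_sub, div_mul_cancel₀ _ hK'.ne', mul_one]
    rw [abs_le]; constructor <;> linarith
  · set u := (x + C) / (2 * C / K) with hu
    have hu0 : 0 ≤ u := by apply div_nonneg <;> linarith
    have huK : u < K := by
      rw [hu, div_lt_iff₀ hstep, mul_div_cancel₀ _ hK'.ne']
      linarith
    have hux : 2 * C / K * u = x + C := by rw [hu, mul_div_cancel₀ _ hstep.ne']
    have hf : ⌊u⌋₊ < K := (Nat.floor_lt hu0).2 huK
    refine ⟨_, fun _ => ⟨⟨⌊u⌋₊, hf, rfl⟩, ?_, hb _ hf⟩⟩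
    have h1 := mul_le_mul_of_nonneg_left (Nat.floor_le hu0) hstep.le
    have h2 := mul_le_mul_of_nonneg_left (Nat.lt_floor_add_one u).le hstep.le
    rw [abs_le]; constructor <;> linarith

theorem numSubgroups_map_le {p d : ℕ} (X : Matrix (Fin p) (Fin d) ℝ) (f : ℝ → ℝ) :
    numSubgroups (X.map f) ≤ numSubgroups X := by
  rw [numSubgroups_eq, numSubgroups_eq]
  have : Set.range (fun i => X.map f i) =
      (fun r : Fin d → ℝ => fun j => f (r j)) '' Set.range fun i => X i := by
    rw [← Set.range_comp]; rfl
  rw [this]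
  exact Set.ncard_image_le (Set.finite_range _)

/-- Rounding alone could push the product beyond the bound `Cm`, so `X` is first shrunk by the
relative rounding error; when that error exceeds `Cm`, the zero factors, which lie on the grid
because `K` is even, are accurate enough. -/
theorem exists_candidate_near {n m d : ℕ} {μ Cx Cy Cm : ℝ} (hCx : 0 ≤ Cx) (hCy : 0 ≤ Cy)
    (hCm : 0 ≤ Cm) (hev : Even (numLevels n m μ)) (hK : 0 < numLevels n m μ)
    {X : Matrix (Fin n) (Fin d) ℝ} {Y : Matrix (Fin m) (Fin d) ℝ}
    (hX : EntryBound X Cx) (hY : EntryBound Y Cy) (hM : EntryBound (X * Y.transpose) Cm) :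
    ∃ F ∈ candidates n m d μ Cx Cy Cm, numSubgroups F.1 ≤ numSubgroups X ∧
      numSubgroups F.2 ≤ numSubgroups Y ∧
      ∀ i j, ((F.1 * F.2.transpose - X * Y.transpose) i j) ^ 2 ≤
        4 * Cm * (d * (4 * Cx * Cy / numLevels n m μ)) := by
  set K := numLevels n m μ with hKdef
  have hK' : (0 : ℝ) < K := by exact_mod_cast hK
  set e : ℝ := d * (4 * Cx * Cy / K) with he
  have he0 : 0 ≤ e := by positivity
  rcases le_or_gt Cm e with hle | hlt
  · have hz : ∀ C : ℝ, ∃ t : ℕ, t < K ∧ (0 : ℝ) = -C + 2 * C / K * t := by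
      intro C
      obtain ⟨k, hk⟩ := hev
      refine ⟨k, by omega, ?_⟩
      have : (K : ℝ) = k + k := by exact_mod_cast hk
      have hk0 : (k : ℝ) ≠ 0 := by rintro h; rw [h] at this; linarith
      rw [this]; field_simp; ring
    have hX0 : (X.map fun _ => (0 : ℝ)) ∈ gridMatrices n d Cx K := fun _ _ => hz Cx
    have hY0 : (Y.map fun _ => (0 : ℝ)) ∈ gridMatrices m d Cy K := fun _ _ => hz Cy
    have hXg := numSubgroups_map_le X fun _ => 0
    have hYg := numSubgroups_map_le Y fun _ => 0
    refine ⟨(X.map fun _ => 0, Y.map fun _ => 0), ⟨hX0, hY0, ?_⟩, hXg, hYg, ?_⟩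
    · intro i j
      simpa [Matrix.mul_apply] using hCm
    · intro i j
      have h0 : ((X.map fun _ => (0 : ℝ)) * (Y.map fun _ => (0 : ℝ)).transpose) i j = 0 := by
        simp [Matrix.mul_apply]
      rw [Matrix.sub_apply, h0, zero_sub, neg_sq, ← sq_abs]
      have := hM i j
      have h1 : |(X * Y.transpose) i j| ^ 2 ≤ Cm ^ 2 := by gcongr
      nlinarith
  · have hCm' : 0 < Cm := he0.trans_lt hlt
    set θ := 1 - e / Cm with hθ
    have hθ0 : 0 ≤ θ := by rw [hθ, sub_nonneg, div_le_one hCm']; exact hlt.le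
    have hθ1 : θ ≤ 1 := by rw [hθ]; linarith [div_nonneg he0 hCm]
    have hθC : θ * Cm = Cm - e := by rw [hθ, sub_mul, div_mul_cancel₀ _ hCm'.ne', one_mul]
    obtain ⟨r, hr⟩ := exists_rounding hCx hK
    obtain ⟨r', hr'⟩ := exists_rounding hCy hK
    have hθX : ∀ i k, |θ * X i k| ≤ Cx := fun i k => by
      rw [abs_mul, abs_of_nonneg hθ0]
      calc θ * |X i k| ≤ 1 * Cx := by gcongr; exact hX i k
        _ = Cx := one_mul _
    have hdist : ∀ i j, |((X.map fun x => r (θ * x)) * (Y.map r').transpose) i j -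
        θ * (X * Y.transpose) i j| ≤ e := by
      intro i j
      simp only [Matrix.mul_apply, Matrix.map_apply, Matrix.transpose_apply]
      rw [Finset.mul_sum, ← Finset.sum_sub_distrib]
      refine (Finset.abs_sum_le_sum_abs _ _).trans ?_
      have hterm : ∀ k : Fin d,
          |r (θ * X i k) * r' (Y j k) - θ * (X i k * Y j k)| ≤ 4 * Cx * Cy / K := by
        intro k
        obtain ⟨-, ha, hb⟩ := hr _ (hθX i k)
        obtain ⟨-, ha', -⟩ := hr' _ (hY j k)
        have : r (θ * X i k) * r' (Y j k) - θ * (X i k * Y j k) =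
            -(r (θ * X i k) * (Y j k - r' (Y j k)) + (θ * X i k - r (θ * X i k)) * Y j k) := by
          ring
        rw [this, abs_neg]
        refine (abs_add_le _ _).trans ?_
        rw [abs_mul, abs_mul]
        calc _ ≤ Cx * (2 * Cy / K) + 2 * Cx / K * Cy := by
              gcongr
              exact hY j k
          _ = _ := by ring
      refine (Finset.sum_le_sum fun k _ => hterm k).trans ?_
      simp [he]
    have hbound : ∀ i j, |((X.map fun x => r (θ * x)) * (Y.map r').transpose) i j| ≤ Cm := by
      intro i j
      have h1 := abs_le.1 (hdist i j)
      have h2 : |θ * (X * Y.transpose) i j| ≤ Cm - e := by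
        rw [abs_mul, abs_of_nonneg hθ0, ← hθC]
        gcongr
        exact hM i j
      have h3 := abs_le.1 h2
      rw [abs_le]; constructor <;> linarith [h1.1, h1.2, h3.1, h3.2]
    have hX1 : (X.map fun x => r (θ * x)) ∈ gridMatrices n d Cx K :=
      fun i k => (hr _ (hθX i k)).1
    have hY1 : Y.map r' ∈ gridMatrices m d Cy K := fun j k => (hr' _ (hY j k)).1
    have hXg := numSubgroups_map_le X fun x => r (θ * x)
    have hYg := numSubgroups_map_le Y r'
    refine ⟨(X.map fun x => r (θ * x), Y.map r'), ⟨hX1, hY1, hbound⟩, hXg, hYg, ?_⟩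
    intro i j
    rw [Matrix.sub_apply]
    set a := ((X.map fun x => r (θ * x)) * (Y.map r').transpose) i j with ha
    set b := (X * Y.transpose) i j with hbdef
    have h2e : |a - b| ≤ 2 * e := by
      have h1 : a - b = (a - θ * b) + -((1 - θ) * b) := by ring
      have h2 : |(1 - θ) * b| ≤ e := by
        rw [abs_mul, abs_of_nonneg (by linarith)]
        calc (1 - θ) * |b| ≤ (1 - θ) * Cm := by
              gcongr
              exact hM i j
          _ = e := by linarith
      rw [h1]
      refine (abs_add_le _ _).trans ?_
      rw [abs_neg]
      linarith [hdist i j]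
    have h2C : |a - b| ≤ 2 * Cm := by
      refine (abs_sub _ _).trans ?_
      linarith [hbound i j, hM i j]
    change (a - b) ^ 2 ≤ _
    rw [← sq_abs, sq]
    calc |a - b| * |a - b| ≤ (2 * Cm) * (2 * e) := by gcongr
      _ = 4 * Cm * e := by ring

/-! ### Size of the grid -/

theorem log_numLevels_bounds {n m : ℕ} {μ : ℝ} (hN : 2 ≤ max n m) (hμ : 1 < μ) :
    μ * Real.log (max n m : ℕ) ≤ Real.log (numLevels n m μ) ∧
      Real.log (numLevels n m μ) ≤ 2 * μ * Real.log (max n m : ℕ) := by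
  have hN' : (2 : ℝ) ≤ (max n m : ℕ) := by exact_mod_cast hN
  have h2 : 0 < Real.log 2 := Real.log_pos one_lt_two
  have hL : Real.log 2 ≤ Real.log (max n m : ℕ) := Real.log_le_log two_pos hN'
  have hL0 : 0 < Real.log (max n m : ℕ) := h2.trans_le hL
  have hx : μ * Real.logb 2 (max n m : ℕ) * Real.log 2 = μ * Real.log (max n m : ℕ) := by
    rw [Real.logb, mul_assoc, div_mul_cancel₀ _ h2.ne']
  have hx0 : 0 ≤ μ * Real.logb 2 (max n m : ℕ) := by
    apply mul_nonneg (by linarith)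
    exact div_nonneg hL0.le h2.le
  have hlog : Real.log (numLevels n m μ) = ⌈μ * Real.logb 2 (max n m : ℕ)⌉₊ * Real.log 2 := by
    rw [numLevels, Nat.cast_pow, Real.log_pow, Nat.cast_ofNat]
  rw [hlog, ← hx]
  constructor
  · gcongr
    exact Nat.le_ceil _
  · have h1 := mul_le_mul_of_nonneg_right (Nat.ceil_lt_add_one hx0).le h2.le
    nlinarith

theorem sq_le_two_mul_numLevels {n m : ℕ} {μ : ℝ} (hN : 2 ≤ max n m) (hμ : 1 < μ) :
    (μ * Real.log (max n m : ℕ)) ^ 2 ≤ 2 * numLevels n m μ := by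
  have hK : (0 : ℝ) < numLevels n m μ := by unfold numLevels; positivity
  have hL : 0 ≤ μ * Real.log (max n m : ℕ) :=
    mul_nonneg (by linarith) (Real.log_natCast_nonneg _)
  have h1 := Real.quadratic_le_exp_of_nonneg hL
  have h2 := (Real.exp_le_exp.2 (log_numLevels_bounds hN hμ).1).trans_eq (Real.exp_log hK)
  linarith

theorem even_numLevels {n m : ℕ} {μ : ℝ} (hN : 2 ≤ max n m) (hμ : 1 < μ) :
    Even (numLevels n m μ) := by
  have h : ⌈μ * Real.logb 2 (max n m : ℕ)⌉₊ ≠ 0 := by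
    rw [Nat.ne_zero_iff_zero_lt, Nat.ceil_pos]
    have : (1 : ℝ) < (max n m : ℕ) := by exact_mod_cast hN
    have := Real.logb_pos one_lt_two this
    positivity
  exact (even_two).pow_of_ne_zero h

/-! ### The criterion and the excess loss -/

open Classical in
theorem proj_apply {n m : ℕ} (S : Set (Fin n × Fin m)) (A : Matrix (Fin n) (Fin m) ℝ)
    (i : Fin n) (j : Fin m) : proj S A i j = if (i, j) ∈ S then A i j else 0 := by
  simp [proj, Set.indicator_apply]

theorem criterion_observe {n m d : ℕ} (lam : ℝ) (Mstar : Matrix (Fin n) (Fin m) ℝ)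
    (q : Data n m) (F : Matrix (Fin n) (Fin d) ℝ × Matrix (Fin m) (Fin d) ℝ) :
    criterion lam ((q.1, proj q.1 (Mstar + Matrix.of q.2)) : Data n m) F =
      frobSq (proj q.1 (Matrix.of q.2)) + (excessLoss (F.1 * F.2.transpose - Mstar) q +
        lam * ((numSubgroups F.1 : ℝ) + numSubgroups F.2)) := by
  classical
  rw [criterion, ← add_assoc]
  congr 1
  change frobSq (proj q.1 (proj q.1 (Mstar + Matrix.of q.2) - F.1 * F.2.transpose)) = _
  unfold frobSq excessLoss
  rw [← Finset.sum_add_distrib]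
  refine Finset.sum_congr rfl fun i _ => ?_
  rw [← Finset.sum_add_distrib]
  refine Finset.sum_congr rfl fun j _ => ?_
  by_cases h : (i, j) ∈ q.1
  · simp only [proj_apply, h, if_true, Matrix.sub_apply, Matrix.add_apply, Matrix.of_apply]
    ring
  · simp [proj_apply, h]

theorem frobSq_le {n m : ℕ} {A : Matrix (Fin n) (Fin m) ℝ} {b : ℝ} (h : ∀ i j, A i j ^ 2 ≤ b) :
    frobSq A ≤ n * m * b := by
  calc frobSq A ≤ ∑ _i : Fin n, ∑ _j : Fin m, b :=
        Finset.sum_le_sum fun i _ => Finset.sum_le_sum fun j _ => h i j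
    _ = n * m * b := by simp [mul_assoc]

theorem frobSq_nonneg {n m : ℕ} (A : Matrix (Fin n) (Fin m) ℝ) : 0 ≤ frobSq A :=
  Finset.sum_nonneg fun _ _ => Finset.sum_nonneg fun _ _ => sq_nonneg _

theorem measurable_frobSq_sub {n m : ℕ} (M : Matrix (Fin n) (Fin m) ℝ) :
    Measurable fun H : Fin n → Fin m → ℝ => frobSq (Matrix.of H - M) := by
  unfold frobSq
  simp only [Matrix.sub_apply, Matrix.of_apply]
  fun_prop

theorem sq_sub_le_of_entryBound {n m : ℕ} {A B : Matrix (Fin n) (Fin m) ℝ} {C : ℝ}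
    (hA : EntryBound A C) (hB : EntryBound B C) (i : Fin n) (j : Fin m) :
    (A - B) i j ^ 2 ≤ 4 * C ^ 2 := by
  rw [Matrix.sub_apply, ← sq_abs]
  have h : |A i j - B i j| ≤ 2 * C := by
    refine (abs_sub _ _).trans ?_
    linarith [hA i j, hB i j]
  calc |A i j - B i j| ^ 2 ≤ (2 * C) ^ 2 := by gcongr
    _ = 4 * C ^ 2 := by ring

/-- The oracle inequality for the family of all candidates, against a fixed candidate `G`. The
hypothesis `hlam` says that the penalty pays for the codes of the distinct rows. -/
theorem risk_le_of_candidate {n m d : ℕ} (p : unitInterval) {μ σ η lam Cx Cy Cm : ℝ}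
    (hn : 0 < n) (hm : 0 < m) (hN : 2 ≤ max n m) (hμ : 1 < μ) (hη : 0 < η)
    (hσ : η * σ ^ 2 ≤ 1 / 4) (hCm : η * Cm ^ 2 ≤ 3 / 16)
    (hlam : 2 * μ * d * Real.log (max n m : ℕ) ≤ η * lam)
    {Mstar : Matrix (Fin n) (Fin m) ℝ} (hM : EntryBound Mstar Cm)
    {G : Matrix (Fin n) (Fin d) ℝ × Matrix (Fin m) (Fin d) ℝ}
    (hG : G ∈ candidates n m d μ Cx Cy Cm)
    {Mhat : Data n m → (Fin n → Fin m → ℝ)}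
    (hint : Integrable (fun D => frobSq (Matrix.of (Mhat D) - Mstar)) (dataLaw p σ Mstar))
    (hest : ∀ᵐ D ∂dataLaw p σ Mstar, IsEstimate d μ Cx Cy Cm lam D (Matrix.of (Mhat D))) :
    p * η / 3 * ∫ D, frobSq (Matrix.of (Mhat D) - Mstar) ∂dataLaw p σ Mstar ≤
      η * (p * frobSq (G.1 * G.2.transpose - Mstar) +
        lam * ((numSubgroups G.1 : ℝ) + numSubgroups G.2)) +
        ((n : ℝ) + m) * Real.log (max n m : ℕ) := by
  classical
  have hK : 0 < numLevels n m μ := by unfold numLevels; positivity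
  have hmeas := measurable_observe Mstar
  have hest' := ae_of_ae_map hmeas.aemeasurable hest
  have hint' := hint.comp_measurable hmeas
  rw [dataLaw, integral_map hmeas.aemeasurable hint.1]
  let V (c : (Fin n → Fin d → Fin (numLevels n m μ)) × (Fin m → Fin d → Fin (numLevels n m μ))) :
      Matrix (Fin n) (Fin m) ℝ := decode Cx c.1 * (decode Cy c.2).transpose
  refine oracle_inequality p hη hσ
    (ι := {c : (Fin n → Fin d → Fin (numLevels n m μ)) ×
      (Fin m → Fin d → Fin (numLevels n m μ)) // EntryBound (V c) Cm})
    (fun c => V c.1 - Mstar) ?_ (fun c => codeWeight c.1.1 * codeWeight c.1.2) ?_ ?_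
    (fun c => ((Set.range c.1.1).ncard : ℝ) + (Set.range c.1.2).ncard) ?_ _ _ _ hint' ?_
  · intro c i j
    have := mul_le_mul_of_nonneg_left (sq_sub_le_of_entryBound c.2 hM i j) hη.le
    linarith
  · exact fun c => mul_pos (codeWeight_pos hn hK _) (codeWeight_pos hm hK _)
  · refine (Finset.sum_map Finset.univ (Function.Embedding.subtype fun c => EntryBound (V c) Cm)
      (fun c => codeWeight c.1 * codeWeight c.2)).symm.le.trans ?_
    refine (Finset.sum_le_sum_of_subset_of_nonneg (Finset.subset_univ _) fun c _ _ =>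
      (mul_pos (codeWeight_pos hn hK _) (codeWeight_pos hm hK _)).le).trans ?_
    rw [← Finset.univ_product_univ, Finset.sum_product, ← Finset.sum_mul_sum]
    exact mul_le_one₀ (sum_codeWeight_le_one hn hK)
      (Finset.sum_nonneg fun U _ => (codeWeight_pos hm hK U).le) (sum_codeWeight_le_one hm hK)
  · intro c
    rw [Real.log_mul (codeWeight_pos hn hK _).ne' (codeWeight_pos hm hK _).ne', neg_add,
      neg_log_codeWeight hn hK, neg_log_codeWeight hm hK]
    have h1 : Real.log n ≤ Real.log (max n m : ℕ) :=
      Real.log_le_log (by exact_mod_cast hn) (by exact_mod_cast le_max_left n m)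
    have h2 : Real.log m ≤ Real.log (max n m : ℕ) :=
      Real.log_le_log (by exact_mod_cast hm) (by exact_mod_cast le_max_right n m)
    have h3 : (d : ℝ) * Real.log (numLevels n m μ) ≤ η * lam := by
      refine le_trans ?_ hlam
      have := mul_le_mul_of_nonneg_left (log_numLevels_bounds hN hμ).2 (Nat.cast_nonneg (α := ℝ) d)
      linarith
    have h4 := mul_le_mul_of_nonneg_left h1 (Nat.cast_nonneg (α := ℝ) n)
    have h5 := mul_le_mul_of_nonneg_left h2 (Nat.cast_nonneg (α := ℝ) m)
    have h6 := mul_le_mul_of_nonneg_right h3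
      (by positivity : (0 : ℝ) ≤ (Set.range c.1.1).ncard + (Set.range c.1.2).ncard)
    linarith
  · have hlam0 : 0 ≤ lam := by
      have : 0 ≤ η * lam := le_trans (by
        have := Real.log_natCast_nonneg (max n m)
        positivity) hlam
      exact nonneg_of_mul_nonneg_right this hη
    filter_upwards [hest'] with q hq
    obtain ⟨F, hF, hMF, hmin⟩ := hq
    obtain ⟨T, hT, hTn⟩ := exists_code hK hF.1
    obtain ⟨U, hU, hUn⟩ := exists_code hK hF.2.1
    have hV : V (T, U) = F.1 * F.2.transpose := by simp only [V, hT, hU]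
    refine ⟨⟨(T, U), by rw [hV]; exact hF.2.2⟩, ?_, ?_⟩
    · change frobSq _ = frobSq (V (T, U) - Mstar)
      rw [hMF, hV]
    · have h1 := hmin G hG
      rw [criterion_observe, criterion_observe] at h1
      have h2 : ((Set.range T).ncard : ℝ) + (Set.range U).ncard ≤
          numSubgroups F.1 + numSubgroups F.2 := by exact_mod_cast add_le_add hTn hUn
      have h3 := mul_le_mul_of_nonneg_left h2 hlam0
      simp only [hV]
      linarith

end SubgroupCompletion

/-! ### The risk bound -/

theorem theorem3 (Cx Cy Cm : ℝ) :
    ∃ C₁ C₂ C₃ : ℝ, 0 < C₁ ∧ 0 < C₂ ∧ 0 < C₃ ∧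
      ∀ (n m d s : ℕ) (_ : 1 ≤ s) (hs : s < n * m) (μ σ lam : ℝ) (_ : 1 < μ) (_ : 0 < σ)
        (Xstar : Matrix (Fin n) (Fin d) ℝ) (Ystar : Matrix (Fin m) (Fin d) ℝ)
        (Mstar : Matrix (Fin n) (Fin m) ℝ) (_ : Mstar = Xstar * Ystar.transpose)
        (_ : SubgroupCompletion.EntryBound Xstar Cx)
        (_ : SubgroupCompletion.EntryBound Ystar Cy)
        (_ : SubgroupCompletion.EntryBound Mstar Cm)
        (_ : 8 * μ * d * (σ ^ 2 + 4 * Cm ^ 2 / 3) * Real.log (max n m : ℕ) ≤ lam)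
        (Mhat : SubgroupCompletion.Data n m → (Fin n → Fin m → ℝ))
        (_ : AEMeasurable Mhat
          (SubgroupCompletion.dataLaw (SubgroupCompletion.sampleProb hs) σ Mstar))
        (_ : ∀ᵐ D ∂SubgroupCompletion.dataLaw (SubgroupCompletion.sampleProb hs) σ Mstar,
          SubgroupCompletion.IsEstimate d μ Cx Cy Cm lam D (Matrix.of (Mhat D))),
        MeasureTheory.Integrable
            (fun D => SubgroupCompletion.frobSq (Matrix.of (Mhat D) - Mstar))
            (SubgroupCompletion.dataLaw (SubgroupCompletion.sampleProb hs) σ Mstar) ∧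
          1 / ((n : ℝ) * m) *
              ∫ D, SubgroupCompletion.frobSq (Matrix.of (Mhat D) - Mstar)
                ∂SubgroupCompletion.dataLaw (SubgroupCompletion.sampleProb hs) σ Mstar ≤
            C₁ * Real.log s / s + d * C₂ / (μ * Real.log (max n m : ℕ)) ^ 2 +
              (6 * lam / Real.log (max n m : ℕ) + μ * C₃) *
                (((m : ℝ) + n + 2) / s * Real.log (max n m : ℕ) +
                  ((SubgroupCompletion.numSubgroups Xstar : ℝ) +
                      SubgroupCompletion.numSubgroups Ystar) * d / s *
                    Real.log (max n m : ℕ)) := by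
  open SubgroupCompletion in
  refine ⟨1, 96 * |Cm * Cx * Cy| + 1, 1, one_pos, by positivity, one_pos, ?_⟩
  intro n m d s hs1 hs μ σ lam hμ hσ Xstar Ystar Mstar hMXY hX hY hM hlam Mhat hmeas hest
  have hnm : 0 < n * m := by omega
  have hn : 0 < n := Nat.pos_of_mul_pos_right hnm
  have hm : 0 < m := Nat.pos_of_mul_pos_left hnm
  have hN : 2 ≤ max n m := by
    by_contra h
    have h1 : n = 1 := by omega
    have h2 : m = 1 := by omega
    subst h1 h2
    omega
  have hCm : 0 ≤ Cm := (abs_nonneg _).trans (hM ⟨0, hn⟩ ⟨0, hm⟩)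
  have hL : 0 < Real.log (max n m : ℕ) := Real.log_pos (by exact_mod_cast hN)
  have hsR : (0 : ℝ) < s := by exact_mod_cast hs1
  have hnR : (0 : ℝ) < n := by exact_mod_cast hn
  have hmR : (0 : ℝ) < m := by exact_mod_cast hm
  have hμ0 : 0 < μ := by linarith
  have hlogs : 0 ≤ Real.log s := Real.log_natCast_nonneg s
  have hlam0 : 0 ≤ lam := le_trans (by positivity) hlam
  set P := dataLaw (sampleProb hs) σ Mstar with hP
  have hint : Integrable (fun D => frobSq (Matrix.of (Mhat D) - Mstar)) P := by
    refine Integrable.of_bound (C := n * m * (4 * Cm ^ 2))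
      ((measurable_frobSq_sub Mstar).comp_aemeasurable hmeas).aestronglyMeasurable ?_
    filter_upwards [hest] with D hD
    obtain ⟨F, hF, hMF, -⟩ := hD
    rw [Real.norm_of_nonneg (frobSq_nonneg _), hMF]
    exact frobSq_le (sq_sub_le_of_entryBound hF.2.2 hM)
  refine ⟨hint, ?_⟩
  rcases Nat.eq_zero_or_pos d with rfl | hd
  · -- with no features both matrices vanish
    have h0 : ∫ D, frobSq (Matrix.of (Mhat D) - Mstar) ∂P = 0 := by
      refine integral_eq_zero_of_ae ?_
      filter_upwards [hest] with D hD
      obtain ⟨F, hF, hMF, -⟩ := hD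
      have e : F.1 * F.2.transpose - Mstar = 0 := by
        rw [hMXY]; ext i j; simp
      rw [hMF, e]
      simp [frobSq]
    rw [h0, mul_zero]
    positivity
  have hCx : 0 ≤ Cx := (abs_nonneg _).trans (hX ⟨0, hn⟩ ⟨0, hd⟩)
  have hCy : 0 ≤ Cy := (abs_nonneg _).trans (hY ⟨0, hm⟩ ⟨0, hd⟩)
  have hdR : (1 : ℝ) ≤ d := by exact_mod_cast hd
  have hK : 0 < numLevels n m μ := by unfold numLevels; positivity
  have hKR : (0 : ℝ) < numLevels n m μ := by exact_mod_cast hK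
  obtain ⟨G, hG, hG1, hG2, hGerr⟩ := exists_candidate_near hCx hCy hCm
    (even_numLevels hN hμ) hK hX hY (hMXY ▸ hM)
  rw [← hMXY] at hGerr
  set v := σ ^ 2 + 4 * Cm ^ 2 / 3 with hv
  have hv0 : 0 < v := by positivity
  have hσv : σ ^ 2 ≤ v := by rw [hv]; linarith [sq_nonneg Cm]
  have hCv : 4 * Cm ^ 2 / 3 ≤ v := by rw [hv]; linarith [sq_nonneg σ]
  have hrisk := risk_le_of_candidate (sampleProb hs) (η := 1 / (4 * v)) (lam := lam) hn hm hN hμ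
    (by positivity)
    (by rw [div_mul_eq_mul_div, div_le_div_iff₀ (by positivity) (by positivity)]; linarith)
    (by rw [div_mul_eq_mul_div, div_le_div_iff₀ (by positivity) (by positivity)]; linarith)
    (by rw [div_mul_eq_mul_div, le_div_iff₀ (by positivity)]; linarith) hM hG hint hest
  set R := ∫ D, frobSq (Matrix.of (Mhat D) - Mstar) ∂P with hR
  set L := Real.log (max n m : ℕ) with hLdef
  set g := (numSubgroups Xstar : ℝ) + numSubgroups Ystar with hg
  have hgG : (numSubgroups G.1 : ℝ) + numSubgroups G.2 ≤ g := by
    rw [hg]; exact_mod_cast add_le_add hG1 hG2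
  have hg0 : 0 ≤ g := by positivity
  have hps : ((sampleProb hs : unitInterval) : ℝ) = s / (n * m) := rfl
  have hbias : 3 * (frobSq (G.1 * G.2.transpose - Mstar) / (n * m)) ≤
      d * (96 * |Cm * Cx * Cy| + 1) / (μ * L) ^ 2 := by
    have h1 : frobSq (G.1 * G.2.transpose - Mstar) / (n * m) ≤
        4 * Cm * (d * (4 * Cx * Cy / numLevels n m μ)) := by
      rw [div_le_iff₀ (by positivity), mul_comm]
      exact frobSq_le hGerr
    have h2 := sq_le_two_mul_numLevels hN hμ
    rw [abs_of_nonneg (by positivity), le_div_iff₀ (by positivity)]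
    calc _ ≤ 3 * (4 * Cm * (d * (4 * Cx * Cy / numLevels n m μ))) *
          (2 * numLevels n m μ) := by gcongr
      _ = d * (96 * (Cm * Cx * Cy)) := by field_simp; ring
      _ ≤ _ := by gcongr; linarith
  -- the noise level costs at most half of `lam` per unit of code length
  have hvL : 4 * v * L ≤ lam / 2 := by
    have h1 : 1 * 1 * (v * L) ≤ μ * d * (v * L) := by gcongr
    linarith
  have hmain : 1 / ((n : ℝ) * m) * R ≤
      3 * (frobSq (G.1 * G.2.transpose - Mstar) / (n * m)) +
        (3 * lam * g + 3 / 2 * lam * (n + m)) / s := by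
    have h1 := mul_le_mul_of_nonneg_left hrisk (by positivity : 0 ≤ 3 * (4 * v) / s)
    rw [hps] at h1
    have e1 : 3 * (4 * v) / s * (s / (n * m) * (1 / (4 * v)) / 3 * R) = 1 / ((n : ℝ) * m) * R := by
      field_simp
    have e2 : 3 * (4 * v) / s * (1 / (4 * v) * (s / (n * m) *
        frobSq (G.1 * G.2.transpose - Mstar) + lam * ((numSubgroups G.1 : ℝ) + numSubgroups G.2)) +
        ((n : ℝ) + m) * L) = 3 * (frobSq (G.1 * G.2.transpose - Mstar) / (n * m)) +
        (3 * lam * ((numSubgroups G.1 : ℝ) + numSubgroups G.2) + 3 * (4 * v * L) * (n + m)) / s := by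
      field_simp
      ring
    rw [e1, e2] at h1
    have h3 : 3 * (4 * v * L) * ((n : ℝ) + m) ≤ 3 * (lam / 2) * (n + m) := by gcongr
    have h4 : 3 * lam * ((numSubgroups G.1 : ℝ) + numSubgroups G.2) ≤ 3 * lam * g := by gcongr
    have h5 : 3 * lam * ((numSubgroups G.1 : ℝ) + numSubgroups G.2) +
        3 * (4 * v * L) * ((n : ℝ) + m) ≤ 3 * lam * g + 3 / 2 * lam * (n + m) := by linarith
    linarith [div_le_div_of_nonneg_right h5 hsR.le]
  have hvar : (3 * lam * g + 3 / 2 * lam * (n + m)) / s ≤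
      (6 * lam / L + μ * 1) * (((m : ℝ) + n + 2) / s * L + g * d / s * L) := by
    have h1 : 6 * lam / L * (((m : ℝ) + n + 2) / s * L + g * d / s * L) =
        6 * lam * (m + n + 2 + g * d) / s := by field_simp
    have h2 : 0 ≤ μ * 1 * (((m : ℝ) + n + 2) / s * L + g * d / s * L) := by positivity
    have h3 : g * 1 ≤ g * d := by gcongr
    have h4 : (3 * lam * g + 3 / 2 * lam * (n + m)) / s ≤
        6 * lam * (m + n + 2 + g * d) / s := by
      refine div_le_div_of_nonneg_right ?_ hsR.le
      have h5 := mul_le_mul_of_nonneg_left h3 hlam0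
      have h6 : 0 ≤ lam * ((n : ℝ) + m) := by positivity
      have h7 : 0 ≤ lam * g := by positivity
      linarith
    rw [add_mul, h1]
    linarith
  have hlog0 : 0 ≤ 1 * Real.log s / s := by positivity
  linarith
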